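/- Setting. An episodic risk-sensitive Markov decision process with horizon $H\ge 1$ has finite nonempty state and action sets $\mathcal S,\mathcal A$ of cardinalities $S,A$, transition kernels $\mathbb P^S_h(\cdot\mid s,a)$ on $\mathcal S$, reward distributions $R_h(\cdot\mid s,a)$ on $[0,1]$ having a density ($h\in[H]=\{1,\dots,H\}$), and a continuous, strictly increasing utility $U:[0,H]\to\mathbb R$ with $U(0)=0$, which is assumed to be $\kappa$-Lipschitz; given $(s_h,a_h)$, the reward $r_h$ and the next state $s_{h+1}$ are independent. A (measurable, deterministic) Markovian policy on the enlarged state space is a family $\pi_h:\mathcal S\times[0,h-1]\to\mathcal A$, $h\in[H]$, that plays $\pi_h(s_h,y_h)$, where $y_h$ is the reward accumulated before time $h$; its value function is $V^\pi_h(s,y)=\mathbb E^\pi[U(y+\sum_{h'=h}^H r_{h'})\mid s_h=s,\,y_h=y]$. An optimal policy $\pi^*$ maximizes $V_h^\pi(s,y)$ for all $h\in[H]$, $s\in\mathcal S$, $y\in[0,h-1]$ simultaneously; a policy $\pi$ is $\epsilon$-optimal if an optimal policy $\pi^*$ exists and $\sup_{s\in\mathcal S,\,y\in[0,h-1]}|V_h^{\pi^*}(s,y)-V_h^{\pi}(s,y)|\le\epsilon$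 for every $h\in[H]$. Algorithm VIGU with parameters $\epsilon_o>0$ and $n\ge 1$. For $b\ge0$ let $G_b=\{0,\epsilon_o,\dots,\lfloor b/\epsilon_o\rfloor\epsilon_o\}$ and let $\mathrm{Proj}_{G_b}$ be the projection of $[0,b]$ to the nearest point of $G_b$ (the smaller one in a tie). For each $(h,s,a)$ query the simulator $n$ times, obtaining i.i.d. samples $(s^i,r^i)\sim \mathbb P_h^S(\cdot\mid s,a)\otimes R_h(\cdot\mid s,a)$, independent across $(h,s,a)$; let $\hat{\mathbb P}^S_h(\cdot\mid s,a)$ be the empirical distribution of the $s^i$ and $\hat R_h(\cdot\mid s,a)$ that of the $\mathrm{Proj}_{G_1}(r^i)$. Put $\hat V_{H+1}(s,y)=U(y)$ and, for $h=H,\dots,1$ and $y\in G_{h-1}$, $\hat Q_h(s,y,a)=\mathbb E_{s'\sim\hat{\mathbb P}^S_h(\cdot\mid s,a),\,r\sim\hat R_h(\cdot\mid s,a)}[\hat V_{h+1}(s',y+r)]$, $\hat V_h(s,y)=\max_a\hat Q_h(s,y,a)$ and $\hat\pi_h(s,y)\in\arg\max_a\hat Q_h(s,y,a)$, with ties broken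 arbitrarily. The output is the policy $(s,y)\mapsto\hat\pi_h(s,\mathrm{Proj}_{G_{h-1}}(y))$, $h\in[H]$. The number of simulator samples used is $HSAn$, and the sample complexity of VIGU, for given $\epsilon_o,\epsilon,p$, is the least such number for which the output is $\epsilon$-optimal with probability at least $1-p$. Statement. Let $\iota_1=\log\big(\tfrac{4H^2SA}{p\,\epsilon_o}\big)$. There are universal constants $c_0,C_0>0$ and $C_1\ge C_0$ such that, for every such decision process, all $\epsilon>0$, $p\in(0,1)$ and all $0<\epsilon_o\le c_0\,\frac{\epsilon}{H\kappa}$, the following hold. 1. If $n\ge1$ and $n\ge C_0\frac{H^6\kappa^2\iota_1}{\epsilon^2}$, then VIGU returns an $\epsilon$-optimal policy with probability at least $1-p$; and if moreover $n\le C\,\frac{H^6\kappa^2\iota_1}{\epsilon^2}$ for some constant $C$, then it uses in total $HSAn\le C\,\frac{H^7SA\kappa^2\iota_1}{\epsilon^2}$ simulator samples. 2. If $\epsilon\le H\kappa$, then there is an integer $n\ge1$ with $C_0\frac{H^6\kappa^2\iota_1}{\epsilon^2}\le n\le C_1\frac{H^6\kappa^2\iota_1}{\epsilon^2}$, and the sample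 complexity of VIGU is at most $C_1\frac{H^7SA\kappa^2\iota_1}{\epsilon^2}$. In particular, with $\epsilon_o=\Theta\big(\frac{\epsilon}{H\kappa}\big)$ and $n=\Theta\big(\frac{H^6\kappa^2\iota_1}{\epsilon^2}\big)$ (suitable constants), VIGU returns an $\epsilon$-optimal policy with probability at least $1-p$ using $O\big(\frac{H^7SA\kappa^2\iota_1}{\epsilon^2}\big)$ simulator samples. -/

import Mathlib

open MeasureTheory ProbabilityTheory Set
open scoped ENNReal NNReal

noncomputable section

namespace VIGU

/-- A risk-sensitive episodic Markov decision process. The element `h : Fin H` (so `h = 0, …, H-1`)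
stands for the timestamp `h + 1` of `{1, …, H}`. The values of the utility outside `[0, H]`
are irrelevant. -/
structure RSMDP (H : ℕ) (S A : Type*) [MeasurableSpace S] where
  /-- transition kernels -/
  P : Fin H → S → A → Measure S
  /-- reward distributions -/
  R : Fin H → S → A → Measure ℝ
  /-- utility function -/
  U : ℝ → ℝ
  P_prob : ∀ h s a, IsProbabilityMeasure (P h s a)
  R_prob : ∀ h s a, IsProbabilityMeasure (R h s a)
  /-- rewards lie in `[0, 1]` -/
  R_supp : ∀ h s a, R h s a (Icc 0 1)ᶜ = 0
  /-- reward distributions have a density -/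
  R_dens : ∀ h s a, R h s a ≪ volume
  U_cont : ContinuousOn U (Icc 0 (H : ℝ))
  U_mono : StrictMonoOn U (Icc 0 (H : ℝ))
  U_zero : U 0 = 0

attribute [instance] RSMDP.P_prob RSMDP.R_prob

/-- Deterministic Markovian policies on the enlarged state space; at timestamp `h : Fin H` only
the cumulative rewards in `[0, h]` matter. -/
structure Policy (H : ℕ) (S A : Type*) [MeasurableSpace A] where
  act : Fin H → S → ℝ → A
  measurable_act : ∀ h s, Measurable (act h s)

/-- The covering net `{0, e, 2e, …, ⌊b/e⌋e}` of `[0, b]`. -/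
def grid (e b : ℝ) : Finset ℝ := (Finset.range (⌊b / e⌋₊ + 1)).image fun k : ℕ => (k : ℝ) * e

/-- Projection of `y ∈ [0, b]` to the nearest point of `grid e b`, the smaller one in case of a
tie (see `gridProj_spec`). -/
def gridProj (e b y : ℝ) : ℝ := ((min ⌈y / e - 1 / 2⌉₊ ⌊b / e⌋₊ : ℕ) : ℝ) * e

theorem gridProj_spec {e b y : ℝ} (he : 0 < e) (hy : y ∈ Icc 0 b) :
    gridProj e b y ∈ grid e b ∧
      ∀ g ∈ grid e b, |y - gridProj e b y| ≤ |y - g| ∧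
        (|y - g| = |y - gridProj e b y| → gridProj e b y ≤ g) := by
  refine ⟨?_, ?_⟩
  · exact Finset.mem_image.2 ⟨_, Finset.mem_range.2 (Nat.lt_succ_of_le (min_le_right _ _)), rfl⟩
  · intro g hg
    obtain ⟨k, hk, rfl⟩ := Finset.mem_image.1 hg
    have hk : k ≤ ⌊b / e⌋₊ := Nat.lt_succ_iff.1 (Finset.mem_range.1 hk)
    set t := y / e with ht
    have hyt : y = t * e := by rw [ht]; field_simp
    have ht0 : 0 ≤ t := div_nonneg hy.1 he.le
    set m : ℕ := min ⌈t - 1 / 2⌉₊ ⌊b / e⌋₊ with hm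
    have hgp : gridProj e b y = m * e := rfl
    have key : |t - m| ≤ |t - k| ∧ (|t - k| = |t - m| → (m : ℝ) ≤ k) := by
      rcases lt_trichotomy k m with hlt | heq | hgt
      · have h1 : (k : ℝ) + 1 ≤ m := by exact_mod_cast hlt
        have h2 : (m : ℝ) - 1 < t - 1 / 2 := by
          have h3 : m - 1 < ⌈t - 1 / 2⌉₊ := by
            have := min_le_left ⌈t - 1 / 2⌉₊ ⌊b / e⌋₊
            omega
          have h4 := Nat.lt_ceil.1 h3
          rwa [Nat.cast_sub (by omega), Nat.cast_one] at h4
        rw [abs_of_nonneg (by linarith : 0 ≤ t - k)]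
        have h5 : |t - m| < t - k := by rw [abs_lt]; constructor <;> linarith
        exact ⟨h5.le, fun h => absurd h h5.ne'⟩
      · subst heq; exact ⟨le_rfl, fun _ => le_rfl⟩
      · have h1 : (m : ℝ) + 1 ≤ k := by exact_mod_cast hgt
        have h2 : m = ⌈t - 1 / 2⌉₊ := by
          rcases min_choice ⌈t - 1 / 2⌉₊ ⌊b / e⌋₊ with h | h <;> omega
        have h3 : t - 1 / 2 ≤ m := by rw [h2]; exact Nat.le_ceil _
        refine ⟨?_, fun _ => by linarith⟩
        rw [abs_le, abs_sub_comm]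
        constructor <;> have := le_abs_self ((k : ℝ) - t) <;> linarith
    have e1 : ∀ c : ℝ, |t * e - c * e| = |t - c| * e := fun c => by
      rw [← sub_mul, abs_mul, abs_of_pos he]
    rw [hgp]
    simp only [hyt, e1]
    refine ⟨mul_le_mul_of_nonneg_right key.1 he.le, fun h => ?_⟩
    exact mul_le_mul_of_nonneg_right (key.2 (mul_right_cancel₀ he.ne' h)) he.le

theorem measurable_comp_gridProj {B : Type*} [MeasurableSpace B] (f : ℝ → B) (e b : ℝ) :
    Measurable fun y => f (gridProj e b y) := by
  have : Measurable fun y : ℝ => min ⌈y / e - 1 / 2⌉₊ ⌊b / e⌋₊ :=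
    (Nat.measurable_ceil.comp (by fun_prop)).min measurable_const
  exact (measurable_from_nat (f := fun m : ℕ => f ((m : ℝ) * e))).comp this

section Model

variable {H : ℕ} {S A : Type*}
  [Fintype S] [MeasurableSpace S] [MeasurableSingletonClass S]
  [Fintype A] [MeasurableSpace A] [MeasurableSingletonClass A]

namespace RSMDP

/-- Transition on the enlarged state space: from `(s, y)` under action `a`, the next state is drawn
from `P h s a`, the reward `r` independently from `R h s a`, and the new enlarged state is
`(s', y + r)`. -/
def trans (M : RSMDP H S A) (h : Fin H) (s : S) (y : ℝ) (a : A) : Measure (S × ℝ) :=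
  ((M.P h s a).prod (M.R h s a)).map fun z => (z.1, y + z.2)

theorem measurable_trans (M : RSMDP H S A) (π : Policy H S A) (h : Fin H) :
    Measurable fun x : S × ℝ => M.trans h x.1 x.2 (π.act h x.1 x.2) := by
  have hact : Measurable fun x : S × ℝ => (x.1, π.act h x.1 x.2) :=
    measurable_fst.prodMk
      (measurable_from_prod_countable_right fun s => π.measurable_act h s)
  let G : Kernel (S × A) (S × ℝ) :=
    ⟨fun x => (M.P h x.1 x.2).prod (M.R h x.1 x.2), measurable_of_countable _⟩
  have : IsMarkovKernel G := ⟨fun x => by dsimp [G]; infer_instance⟩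
  let K : Kernel (S × ℝ) (S × ℝ) :=
    ((Kernel.deterministic Prod.snd measurable_snd) ×ₖ (G.comap _ hact)).map
      fun w : ℝ × (S × ℝ) => (w.2.1, w.1 + w.2.2)
  have hm : Measurable fun w : ℝ × (S × ℝ) => (w.2.1, w.1 + w.2.2) := by fun_prop
  have hK : (fun x : S × ℝ => M.trans h x.1 x.2 (π.act h x.1 x.2)) = fun x => K x := by
    funext x
    simp only [K, Kernel.map_apply _ hm, Kernel.prod_apply, Kernel.deterministic_apply,
      Kernel.comap_apply, G, Kernel.coe_mk, RSMDP.trans]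
    rw [Measure.dirac_prod, Measure.map_map hm (by fun_prop)]
    rfl
  rw [hK]
  exact K.measurable

/-- The transition kernel of the enlarged state `(s_h, y_h)` at timestamp `h` under `π`. -/
def step (M : RSMDP H S A) (π : Policy H S A) (h : Fin H) : Kernel (S × ℝ) (S × ℝ) :=
  ⟨fun x => M.trans h x.1 x.2 (π.act h x.1 x.2), M.measurable_trans π h⟩

/-- `M.finalLaw π h (s, y)` is the law under `π` of the enlarged state at the end of the episode
(final state, cumulative reward `y + ∑ r`) for the process that is in `(s, y)` at timestamp `h`.
The element `Fin.last H` is the end of the episode. -/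
def finalLaw (M : RSMDP H S A) (π : Policy H S A) : Fin (H + 1) → Kernel (S × ℝ) (S × ℝ) :=
  Fin.reverseInduction (motive := fun _ => Kernel (S × ℝ) (S × ℝ)) Kernel.id
    fun h K => K ∘ₖ M.step π h

/-- The value function of `π`: the expected utility of the final cumulative reward when the
process is in `(s, y)` at timestamp `h`. -/
def value (M : RSMDP H S A) (π : Policy H S A) (h : Fin (H + 1)) (s : S) (y : ℝ) : ℝ :=
  ∫ x, M.U x.2 ∂(M.finalLaw π h (s, y))

/-- `π` is an optimal Markovian policy: it maximizes the value function at all timestamps and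
all enlarged states. -/
def IsOptimal (M : RSMDP H S A) (π : Policy H S A) : Prop :=
  ∀ π' : Policy H S A, ∀ h : Fin H, ∀ s : S, ∀ y ∈ Icc (0 : ℝ) (h : ℝ),
    M.value π' h.castSucc s y ≤ M.value π h.castSucc s y

/-- `π` is `ε`-optimal: an optimal Markovian policy exists, and its value function differs by at
most `ε` from that of `π` in the supremum norm, at every timestamp. (All optimal policies have the
same value function on the enlarged state space.) -/
def IsEpsOptimal (M : RSMDP H S A) (ε : ℝ) (π : Policy H S A) : Prop :=
  ∃ πs : Policy H S A, M.IsOptimal πs ∧ ∀ h : Fin H, ∀ s : S, ∀ y ∈ Icc (0 : ℝ) (h : ℝ),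
    |M.value πs h.castSucc s y - M.value π h.castSucc s y| ≤ ε

end RSMDP

/-- The simulator queries: for each timestamp, state and action, `n` queries. -/
abbrev Query (H : ℕ) (S A : Type*) (n : ℕ) := Fin H × S × A × Fin n

/-- The simulator answers: a next state and a reward for each query. -/
abbrev Data (H : ℕ) (S A : Type*) (n : ℕ) := Query H S A n → S × ℝ

/-- The number of simulator samples that the algorithm uses. -/
def numSamples (H : ℕ) (S A : Type*) [Fintype S] [Fintype A] (n : ℕ) : ℕ :=
  Fintype.card (Query H S A n)

/-- The law of the simulator answers: they are independent, and the answer to a query for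
`(h, s, a)` has law `P h s a ⊗ R h s a`. -/
def RSMDP.dataLaw (M : RSMDP H S A) (n : ℕ) : Measure (Data H S A n) :=
  Measure.pi fun q => (M.P q.1 q.2.1 q.2.2.1).prod (M.R q.1 q.2.1 q.2.2.1)

section Algorithm

variable {n : ℕ}

open Classical in
/-- Empirical transition probabilities. -/
def hatP (D : Data H S A n) (h : Fin H) (s : S) (a : A) (s' : S) : ℝ :=
  ((Finset.univ.filter fun i : Fin n => (D (h, s, a, i)).1 = s').card : ℝ) / n

open Classical in
/-- Empirical distribution of the rewards projected to the net of `[0, 1]`. -/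
def hatR (e : ℝ) (D : Data H S A n) (h : Fin H) (s : S) (a : A) (r : ℝ) : ℝ :=
  ((Finset.univ.filter fun i : Fin n => gridProj e 1 (D (h, s, a, i)).2 = r).card : ℝ) / n

/-- Expectation of `V (s', y + r)` with `s'` from `hatP` and `r` from `hatR`. -/
def hatBackup (e : ℝ) (D : Data H S A n) (h : Fin H) (V : S → ℝ → ℝ) (s : S) (y : ℝ) (a : A) :
    ℝ :=
  ∑ s' : S, ∑ r ∈ grid e 1, hatP D h s a s' * hatR e D h s a r * V s' (y + r)

/-- The estimated value function, by value iteration from the end of the episode. -/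
def hatV [Nonempty A] (U : ℝ → ℝ) (e : ℝ) (D : Data H S A n) : Fin (H + 1) → S → ℝ → ℝ :=
  Fin.reverseInduction (motive := fun _ => S → ℝ → ℝ) (fun _ y => U y)
    fun h V s y => Finset.univ.sup' Finset.univ_nonempty fun a => hatBackup e D h V s y a

/-- The estimated Q function. -/
def hatQ [Nonempty A] (U : ℝ → ℝ) (e : ℝ) (D : Data H S A n) (h : Fin H) (s : S) (y : ℝ) (a : A) :
    ℝ :=
  hatBackup e D h (hatV U e D h.succ) s y a

/-- The policy interpolation: play the policy given on the nets at the projected cumulative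
reward. Only the values of `g h s` on `grid e h` matter. -/
def interpolate (e : ℝ) (g : Fin H → S → ℝ → A) : Policy H S A where
  act h s y := g h s (gridProj e (h : ℝ) y)
  measurable_act h s := measurable_comp_gridProj (g h s) e (h : ℝ)

/-- `π` is an output of the algorithm VIGU with utility `U` and discretization `e` on the simulator
answers `D`: it is the interpolation of a policy on the nets that is greedy for the estimated
Q function. Ties in the argmax may be broken in any way, so there may be several outputs. -/
def IsOutput [Nonempty A] (U : ℝ → ℝ) (e : ℝ) (D : Data H S A n) (π : Policy H S A) : Prop :=
  ∃ g : Fin H → S → ℝ → A,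
    (∀ h : Fin H, ∀ s : S, ∀ y ∈ grid e (h : ℝ), ∀ a : A,
      hatQ U e D h s y a ≤ hatQ U e D h s y (g h s y)) ∧
    π = interpolate e g

/-- The algorithm always has an output. -/
theorem exists_isOutput [Nonempty A] (U : ℝ → ℝ) (e : ℝ) (D : Data H S A n) :
    ∃ π : Policy H S A, IsOutput U e D π := by
  choose g hg using fun (h : Fin H) (s : S) (y : ℝ) => Finite.exists_max (hatQ U e D h s y)
  exact ⟨interpolate e g, g, fun h s y _ a => hg h s y a, rfl⟩

end Algorithm

/-- With `n` simulator queries for each timestamp, state and action, and discretization `e`, the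
algorithm VIGU returns an `ε`-optimal policy with probability at least `1 - p`, however ties are
broken. -/
def RSMDP.Succeeds [Nonempty A] (M : RSMDP H S A) (e ε p : ℝ) (n : ℕ) : Prop :=
  ENNReal.ofReal (1 - p) ≤
    M.dataLaw n {D | ∀ π : Policy H S A, IsOutput M.U e D π → M.IsEpsOptimal ε π}

/-- `N` is the sample complexity of VIGU with discretization `e`: the least number of simulator
samples with which it returns an `ε`-optimal policy with probability at least `1 - p`. -/
def RSMDP.IsSampleComplexity [Nonempty A] (M : RSMDP H S A) (e ε p : ℝ) (N : ℕ) : Prop :=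
  IsLeast {m | ∃ n : ℕ, 0 < n ∧ m = numSamples H S A n ∧ M.Succeeds e ε p n} N

/-- The logarithmic factor `log (4 H² S A / (p e))`. -/
def iota (H : ℕ) (S A : Type*) [Fintype S] [Fintype A] (p e : ℝ) : ℝ :=
  Real.log (4 * (H : ℝ) ^ 2 * Fintype.card S * Fintype.card A / (p * e))

end Model

end VIGU

end

set_option linter.unusedSectionVars false

noncomputable section

namespace VIGU

section Grid

theorem gridProj_mem_grid (e b y : ℝ) : gridProj e b y ∈ grid e b :=
  Finset.mem_image.2 ⟨_, Finset.mem_range.2 (Nat.lt_succ_of_le (min_le_right _ _)), rfl⟩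

theorem abs_sub_gridProj_le {e b y : ℝ} (he : 0 < e) (hy : y ∈ Icc 0 b) :
    |y - gridProj e b y| ≤ e := by
  have hk : ((⌊y / e⌋₊ : ℕ) : ℝ) * e ∈ grid e b :=
    Finset.mem_image.2 ⟨_, Finset.mem_range.2 (Nat.lt_succ_of_le
      (Nat.floor_le_floor (div_le_div_of_nonneg_right hy.2 he.le))), rfl⟩
  refine ((gridProj_spec he hy).2 _ hk).1.trans ?_
  have h1 := Nat.floor_le (div_nonneg hy.1 he.le)
  have h2 := Nat.lt_floor_add_one (y / e)
  rw [le_div_iff₀ he] at h1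
  rw [div_lt_iff₀ he] at h2
  rw [abs_le]
  constructor <;> linarith

theorem mem_Icc_of_mem_grid {e b y : ℝ} (he : 0 < e) (hb : 0 ≤ b) (hy : y ∈ grid e b) :
    y ∈ Icc 0 b := by
  obtain ⟨k, hk, rfl⟩ := Finset.mem_image.1 hy
  refine ⟨by positivity, ?_⟩
  rw [← le_div_iff₀ he]
  exact (Nat.cast_le.2 (Nat.lt_succ_iff.1 (Finset.mem_range.1 hk))).trans
    (Nat.floor_le (div_nonneg hb he.le))

theorem add_mem_grid {e b c y r : ℝ} (he : 0 < e) (hb : 0 ≤ b) (hc : 0 ≤ c)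
    (hy : y ∈ grid e b) (hr : r ∈ grid e c) : y + r ∈ grid e (b + c) := by
  have hy' := (mem_Icc_of_mem_grid he hb hy).2
  have hr' := (mem_Icc_of_mem_grid he hc hr).2
  obtain ⟨k, -, rfl⟩ := Finset.mem_image.1 hy
  obtain ⟨l, -, rfl⟩ := Finset.mem_image.1 hr
  refine Finset.mem_image.2 ⟨k + l, Finset.mem_range.2 (Nat.lt_succ_of_le (Nat.le_floor ?_)), ?_⟩
  · rw [le_div_iff₀ he]; push_cast; linarith
  · push_cast; ring

theorem measurable_gridProj (e b : ℝ) : Measurable (gridProj e b) :=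
  measurable_comp_gridProj id e b

theorem card_grid_le {e b : ℝ} (he : 0 < e) (hb : 0 ≤ b) : ((grid e b).card : ℝ) ≤ b / e + 1 := by
  have h1 : (grid e b).card ≤ ⌊b / e⌋₊ + 1 :=
    Finset.card_image_le.trans (Finset.card_range _).le
  have h2 := Nat.floor_le (div_nonneg hb he.le)
  have h3 : ((grid e b).card : ℝ) ≤ ⌊b / e⌋₊ + 1 := by exact_mod_cast h1
  linarith

theorem grid_mono {e b c : ℝ} (he : 0 < e) (hbc : b ≤ c) : grid e b ⊆ grid e c :=
  Finset.image_subset_image (Finset.range_mono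
    (Nat.succ_le_succ (Nat.floor_le_floor (div_le_div_of_nonneg_right hbc he.le))))

end Grid

section Argmax

theorem exists_measurable_argmax {X A : Type*} [MeasurableSpace X] [Fintype A] [Nonempty A]
    [MeasurableSpace A] [MeasurableSingletonClass A] (Q : X → A → ℝ)
    (hQ : ∀ a, Measurable fun x => Q x a) :
    ∃ g : X → A, Measurable g ∧ ∀ x a, Q x a ≤ Q x (g x) := by
  classical
  have hQ' : Measurable fun z : X × A => Q z.1 z.2 := measurable_from_prod_countable_left hQ
  suffices H : ∀ s : Finset A, ∃ g : X → A, Measurable g ∧ ∀ x, ∀ a ∈ s, Q x a ≤ Q x (g x) by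
    obtain ⟨g, hg, h⟩ := H Finset.univ
    exact ⟨g, hg, fun x a => h x a (Finset.mem_univ a)⟩
  intro s
  induction s using Finset.induction_on with
  | empty => exact ⟨fun _ => Classical.arbitrary A, measurable_const, by simp⟩
  | insert b s _ ih =>
    obtain ⟨g, hg, h⟩ := ih
    refine ⟨fun x => if Q x (g x) ≤ Q x b then b else g x,
      Measurable.ite (measurableSet_le (hQ'.comp (measurable_id.prodMk hg)) (hQ b))
        measurable_const hg, fun x a ha => ?_⟩
    rcases Finset.mem_insert.1 ha with rfl | ha
    · dsimp only
      split_ifs with h1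
      · exact le_rfl
      · exact (not_le.1 h1).le
    · dsimp only
      split_ifs with h1
      · exact (h x a ha).trans h1
      · exact h x a ha

theorem abs_sup'_sub_sup'_le {A : Type*} {s : Finset A} (hs : s.Nonempty) {f g : A → ℝ} {c : ℝ}
    (h : ∀ a ∈ s, |f a - g a| ≤ c) : |s.sup' hs f - s.sup' hs g| ≤ c := by
  have key : ∀ f g : A → ℝ, (∀ a ∈ s, |f a - g a| ≤ c) → s.sup' hs f - s.sup' hs g ≤ c := by
    intro f g h
    rw [sub_le_iff_le_add]
    refine Finset.sup'_le _ _ fun a ha => ?_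
    have h1 := Finset.le_sup' g ha
    have h2 := (abs_le.1 (h a ha)).2
    linarith
  rw [abs_le]
  have h1 := key f g h
  have h2 := key g f fun a ha => by rw [abs_sub_comm]; exact h a ha
  constructor <;> linarith

end Argmax

section Concentration

variable {H : ℕ} {S A : Type*} [Fintype S] [MeasurableSpace S] [MeasurableSingletonClass S]
  [Fintype A] {n : ℕ}

instance (M : RSMDP H S A) (n : ℕ) : IsProbabilityMeasure (M.dataLaw n) := by
  unfold RSMDP.dataLaw; infer_instance

theorem integral_dataLaw_eval (M : RSMDP H S A) (q : Query H S A n) {φ : S × ℝ → ℝ}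
    (hφ : Measurable φ) :
    ∫ D, φ (D q) ∂M.dataLaw n = ∫ x, φ x ∂(M.P q.1 q.2.1 q.2.2.1).prod (M.R q.1 q.2.1 q.2.2.1) := by
  have hp := measurePreserving_eval
    (fun q : Query H S A n => (M.P q.1 q.2.1 q.2.2.1).prod (M.R q.1 q.2.1 q.2.2.1)) q
  conv_rhs => rw [← hp.map_eq]
  rw [integral_map (measurable_pi_apply q).aemeasurable hφ.aestronglyMeasurable]
  rfl

/-- One-sided Hoeffding inequality for the simulator answers to the queries for `(h, s, a)`. -/
theorem measureReal_sum_deviation_le (M : RSMDP H S A) (h : Fin H) (s : S) (a : A)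
    {φ : S × ℝ → ℝ} (hφ : Measurable φ) {l b : ℝ} (hb : ∀ x, φ x ∈ Icc l b) {t : ℝ} (ht : 0 ≤ t) :
    (M.dataLaw n).real {D | t ≤ ∑ i : Fin n,
      (φ (D (h, s, a, i)) - ∫ x, φ x ∂(M.P h s a).prod (M.R h s a))} ≤
      Real.exp (-2 * t ^ 2 / (n * (b - l) ^ 2)) := by
  set m := ∫ x, φ x ∂(M.P h s a).prod (M.R h s a) with hm
  have hind : iIndepFun (fun (i : Fin n) (D : Data H S A n) => φ (D (h, s, a, i)) - m)
      (M.dataLaw n) := by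
    have h0 := iIndepFun_pi (X := fun (_ : Query H S A n) (x : S × ℝ) => φ x - m)
      (μ := fun q : Query H S A n => (M.P q.1 q.2.1 q.2.2.1).prod (M.R q.1 q.2.1 q.2.2.1))
      (fun q => (hφ.sub_const m).aemeasurable)
    exact h0.precomp (g := fun i : Fin n => (h, s, a, i)) fun i j hij => by simpa using hij
  have hsub : ∀ i ∈ (Finset.univ : Finset (Fin n)), HasSubgaussianMGF
      (fun D : Data H S A n => φ (D (h, s, a, i)) - m) ((‖b - l‖₊ / 2) ^ 2) (M.dataLaw n) := by
    intro i _
    have h1 := hasSubgaussianMGF_of_mem_Icc (μ := M.dataLaw n)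
      (X := fun D : Data H S A n => φ (D (h, s, a, i))) (a := l) (b := b)
      (hφ.comp (measurable_pi_apply _)).aemeasurable (ae_of_all _ fun D => hb _)
    rwa [integral_dataLaw_eval M _ hφ] at h1
  refine (HasSubgaussianMGF.measure_sum_ge_le_of_iIndepFun hind hsub ht).trans_eq ?_
  congr 1
  simp only [Finset.sum_const, Finset.card_univ, Fintype.card_fin, nsmul_eq_mul]
  push_cast
  rw [Real.norm_eq_abs, div_pow, sq_abs]
  rw [show 2 * ((n : ℝ) * ((b - l) ^ 2 / 2 ^ 2)) = (n * (b - l) ^ 2) / 2 by ring, div_div_eq_mul_div]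
  ring

/-- Hoeffding inequality for the empirical mean over the simulator answers to the queries for
`(h, s, a)`. -/
theorem measureReal_mean_deviation_le (M : RSMDP H S A) (hn : 0 < n) (h : Fin H) (s : S) (a : A)
    {φ : S × ℝ → ℝ} (hφ : Measurable φ) {b : ℝ} (hb : ∀ x, φ x ∈ Icc 0 b) {δ : ℝ} (hδ : 0 ≤ δ) :
    (M.dataLaw n).real {D | δ ≤ |(∑ i : Fin n, φ (D (h, s, a, i))) / n
      - ∫ x, φ x ∂(M.P h s a).prod (M.R h s a)|} ≤ 2 * Real.exp (-2 * n * δ ^ 2 / b ^ 2) := by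
  have hn' : (0 : ℝ) < n := Nat.cast_pos.2 hn
  have h1 := measureReal_sum_deviation_le (n := n) M h s a hφ hb (mul_nonneg hn'.le hδ)
  have h2 := measureReal_sum_deviation_le (n := n) M h s a (φ := fun x => - φ x) hφ.neg (l := -b)
    (b := 0) (fun x => ⟨neg_le_neg (hb x).2, by have := (hb x).1; linarith⟩) (mul_nonneg hn'.le hδ)
  have he : ∀ c : ℝ, -2 * ((n : ℝ) * δ) ^ 2 / (n * c) = -2 * n * δ ^ 2 / c := fun c => by
    rw [show -2 * ((n : ℝ) * δ) ^ 2 = n * (-2 * n * δ ^ 2) by ring, mul_div_mul_left _ _ hn'.ne']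
  rw [he, sub_zero] at h1
  rw [he, zero_sub, neg_neg] at h2
  rw [two_mul]
  refine (measureReal_mono ?_).trans ((measureReal_union_le _ _).trans (add_le_add h1 h2))
  intro D hD
  simp only [mem_ofPred_eq, mem_union, Finset.sum_sub_distrib, integral_neg, Finset.sum_neg_distrib,
    Finset.sum_const, Finset.card_univ, Fintype.card_fin, nsmul_eq_mul] at hD ⊢
  set m := ∫ x, φ x ∂(M.P h s a).prod (M.R h s a)
  have hs : (∑ i : Fin n, φ (D (h, s, a, i))) = n * ((∑ i : Fin n, φ (D (h, s, a, i))) / n) := by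
    field_simp
  rw [hs]
  rcases le_abs.1 hD with hD | hD
  · left; nlinarith
  · right; nlinarith

end Concentration

theorem abs_integral_sub_integral_le {X : Type*} [MeasurableSpace X] {μ : Measure X}
    [IsProbabilityMeasure μ] {f g : X → ℝ} (hf : Integrable f μ) (hg : Integrable g μ) {c : ℝ}
    (h : ∀ᵐ x ∂μ, |f x - g x| ≤ c) : |∫ x, f x ∂μ - ∫ x, g x ∂μ| ≤ c := by
  rw [← integral_sub hf hg]
  have := norm_integral_le_of_norm_le_const (μ := μ) (f := fun x => f x - g x) h
  simpa using this

theorem integral_mem_Icc_of_forall {X : Type*} [MeasurableSpace X] {μ : Measure X}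
    [IsProbabilityMeasure μ] {f : X → ℝ} (hf : Measurable f) {B : ℝ} (h : ∀ x, f x ∈ Icc 0 B) :
    ∫ x, f x ∂μ ∈ Icc 0 B := by
  refine ⟨integral_nonneg fun x => (h x).1, ?_⟩
  have h1 := integral_mono (μ := μ)
    (Integrable.of_mem_Icc 0 B hf.aemeasurable (ae_of_all _ h)) (integrable_const B)
    fun x => (h x).2
  simpa using h1

/-- Functions on the enlarged state space with values in `[0, B]` that are `K`-Lipschitz in the
cumulative reward. -/
structure IsRegular {S : Type*} (K : ℝ≥0) (B : ℝ) (V : S → ℝ → ℝ) : Prop where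
  mem_Icc : ∀ s y, V s y ∈ Icc 0 B
  lipschitz : ∀ s y y', |V s y - V s y'| ≤ K * |y - y'|

section Backup

variable {H : ℕ} {S A : Type*} [Fintype S] [MeasurableSpace S] [MeasurableSingletonClass S]

namespace IsRegular

variable {K : ℝ≥0} {B : ℝ} {V : S → ℝ → ℝ}

theorem measurable (hV : IsRegular K B V) : Measurable fun x : S × ℝ => V x.1 x.2 :=
  measurable_from_prod_countable_right fun s =>
    (LipschitzWith.of_dist_le_mul (hV.lipschitz s)).continuous.measurable

theorem measurable_add (hV : IsRegular K B V) {ρ : ℝ → ℝ} (hρ : Measurable ρ) (y : ℝ) :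
    Measurable fun x : S × ℝ => V x.1 (y + ρ x.2) :=
  hV.measurable.comp (measurable_fst.prodMk ((hρ.comp measurable_snd).const_add y))

theorem integrable_add (hV : IsRegular K B V) {ρ : ℝ → ℝ} (hρ : Measurable ρ) (y : ℝ)
    (μ : Measure (S × ℝ)) [IsFiniteMeasure μ] :
    Integrable (fun x : S × ℝ => V x.1 (y + ρ x.2)) μ :=
  Integrable.of_mem_Icc 0 B (hV.measurable_add hρ y).aemeasurable
    (ae_of_all _ fun _ => hV.mem_Icc _ _)

end IsRegular

variable (M : RSMDP H S A) (ρ : ℝ → ℝ)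

/-- Expectation of `V (s', y + ρ r)` under the transition and reward laws of `(h, s, a)`. -/
def RSMDP.backup (h : Fin H) (V : S → ℝ → ℝ) (s : S) (y : ℝ) (a : A) : ℝ :=
  ∫ x, V x.1 (y + ρ x.2) ∂(M.P h s a).prod (M.R h s a)

variable {ρ} {K : ℝ≥0} {B : ℝ} {V : S → ℝ → ℝ}

theorem RSMDP.ae_reward_mem_Icc (h : Fin H) (s : S) (a : A) :
    ∀ᵐ x ∂(M.P h s a).prod (M.R h s a), x.2 ∈ Icc (0 : ℝ) 1 :=
  (Measure.quasiMeasurePreserving_snd (μ := M.P h s a) (ν := M.R h s a)).ae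
    (mem_ae_iff.2 (M.R_supp h s a) : ∀ᵐ r ∂M.R h s a, r ∈ Icc (0 : ℝ) 1)

theorem backup_mem_Icc (hρ : Measurable ρ) (hV : IsRegular K B V) (h : Fin H) (s : S) (y : ℝ)
    (a : A) : M.backup ρ h V s y a ∈ Icc 0 B :=
  integral_mem_Icc_of_forall (hV.measurable_add hρ y) fun _ => hV.mem_Icc _ _

theorem abs_backup_sub_backup_le (hρ : Measurable ρ) (hV : IsRegular K B V) (h : Fin H) (s : S)
    (y y' : ℝ) (a : A) : |M.backup ρ h V s y a - M.backup ρ h V s y' a| ≤ K * |y - y'| := by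
  refine abs_integral_sub_integral_le (hV.integrable_add hρ y _) (hV.integrable_add hρ y' _)
    (ae_of_all _ fun x => (hV.lipschitz _ _ _).trans_eq ?_)
  rw [add_sub_add_right_eq_sub]

variable [Fintype A] [Nonempty A]

variable (ρ) in
/-- Value iteration with terminal utility `u` for the process whose rewards are transformed
by `ρ`. -/
def RSMDP.bellman (u : ℝ → ℝ) : Fin (H + 1) → S → ℝ → ℝ :=
  Fin.reverseInduction (motive := fun _ => S → ℝ → ℝ) (fun _ y => u y)
    fun h V s y => Finset.univ.sup' Finset.univ_nonempty fun a => M.backup ρ h V s y a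

theorem bellman_last (u : ℝ → ℝ) (s : S) (y : ℝ) : M.bellman ρ u (Fin.last H) s y = u y := by
  simp only [RSMDP.bellman, Fin.reverseInduction_last]

theorem bellman_castSucc (u : ℝ → ℝ) (h : Fin H) (s : S) (y : ℝ) :
    M.bellman ρ u h.castSucc s y = Finset.univ.sup' Finset.univ_nonempty
      fun a => M.backup ρ h (M.bellman ρ u h.succ) s y a := by
  simp only [RSMDP.bellman, Fin.reverseInduction_castSucc]

theorem backup_le_bellman (u : ℝ → ℝ) (h : Fin H) (s : S) (y : ℝ) (a : A) :
    M.backup ρ h (M.bellman ρ u h.succ) s y a ≤ M.bellman ρ u h.castSucc s y := by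
  rw [bellman_castSucc]
  exact Finset.le_sup' (fun a => M.backup ρ h (M.bellman ρ u h.succ) s y a) (Finset.mem_univ a)

theorem isRegular_bellman {u : ℝ → ℝ} (hρ : Measurable ρ) (hu : ∀ y, u y ∈ Icc 0 B)
    (hL : ∀ y y', |u y - u y'| ≤ K * |y - y'|) (h : Fin (H + 1)) :
    IsRegular K B (M.bellman ρ u h) := by
  induction h using Fin.reverseInduction with
  | last => exact ⟨fun s y => by rw [bellman_last]; exact hu y,
      fun s y y' => by rw [bellman_last, bellman_last]; exact hL y y'⟩
  | cast h ih =>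
    refine ⟨fun s y => ?_, fun s y y' => ?_⟩
    · rw [bellman_castSucc]
      obtain ⟨a⟩ := ‹Nonempty A›
      exact ⟨Finset.le_sup'_of_le _ (Finset.mem_univ a) (backup_mem_Icc M hρ ih h s y a).1,
        Finset.sup'_le _ _ fun a _ => (backup_mem_Icc M hρ ih h s y a).2⟩
    · rw [bellman_castSucc, bellman_castSucc]
      exact abs_sup'_sub_sup'_le _ fun a _ => abs_backup_sub_backup_le M hρ ih h s y y' a

/-- Transforming the rewards by a map that is within `e` of the identity changes the optimal values
by at most `K * e` per remaining step. -/
theorem abs_bellman_id_sub_bellman_le {u : ℝ → ℝ} (hρ : Measurable ρ) (hu : ∀ y, u y ∈ Icc 0 B)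
    (hL : ∀ y y', |u y - u y'| ≤ K * |y - y'|) {e : ℝ} (he : ∀ r ∈ Icc (0 : ℝ) 1, |r - ρ r| ≤ e)
    (h : Fin (H + 1)) (s : S) (y : ℝ) :
    |M.bellman id u h s y - M.bellman ρ u h s y| ≤ ((H : ℝ) - h) * (K * e) := by
  induction h using Fin.reverseInduction generalizing s y with
  | last => simp [bellman_last]
  | cast h ih =>
    rw [bellman_castSucc, bellman_castSucc]
    refine abs_sup'_sub_sup'_le _ fun a _ => ?_
    have h1 := isRegular_bellman M measurable_id hu hL h.succ
    have h2 := isRegular_bellman M hρ hu hL h.succ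
    refine abs_integral_sub_integral_le (h1.integrable_add measurable_id y _)
      (h2.integrable_add hρ y _) ?_
    filter_upwards [M.ae_reward_mem_Icc h s a] with x hx
    have h3 := ih x.1 (y + id x.2)
    have h4 := h2.lipschitz x.1 (y + id x.2) (y + ρ x.2)
    rw [add_sub_add_left_eq_sub] at h4
    have h5 := mul_le_mul_of_nonneg_left (he x.2 hx) K.2
    have h6 := abs_sub_le (M.bellman id u h.succ x.1 (y + id x.2))
      (M.bellman ρ u h.succ x.1 (y + id x.2)) (M.bellman ρ u h.succ x.1 (y + ρ x.2))
    simp only [Fin.val_succ, Fin.val_castSucc, id, NNReal.val_eq_coe] at *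
    push_cast at *
    linarith

end Backup

section Clamp

variable {H : ℕ} {S A : Type*} [MeasurableSpace S] (M : RSMDP H S A)

/-- The utility function, extended to the real line by its boundary values. -/
def RSMDP.clampU (M : RSMDP H S A) (y : ℝ) : ℝ := M.U (max 0 (min H y))

theorem clampU_eq {y : ℝ} (hy : y ∈ Icc (0 : ℝ) H) : M.clampU y = M.U y := by
  rw [RSMDP.clampU, min_eq_right hy.2, max_eq_right hy.1]

theorem max_min_mem_Icc {b : ℝ} (hb : 0 ≤ b) (y : ℝ) : max 0 (min b y) ∈ Icc 0 b :=
  ⟨le_max_left _ _, max_le hb (min_le_left _ _)⟩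

variable {K : ℝ≥0}

theorem abs_clampU_sub_le (hK : LipschitzOnWith K M.U (Icc 0 (H : ℝ))) (y y' : ℝ) :
    |M.clampU y - M.clampU y'| ≤ K * |y - y'| := by
  have hH : (0 : ℝ) ≤ H := Nat.cast_nonneg H
  have h1 := hK.dist_le_mul _ (max_min_mem_Icc hH y) _ (max_min_mem_Icc hH y')
  rw [Real.dist_eq, Real.dist_eq] at h1
  refine h1.trans (mul_le_mul_of_nonneg_left ?_ K.2)
  refine (abs_max_sub_max_le_max _ _ _ _).trans
    (max_le (by simp) ((abs_min_sub_min_le_max _ _ _ _).trans (max_le (by simp) le_rfl)))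

theorem measurable_clampU (hK : LipschitzOnWith K M.U (Icc 0 (H : ℝ))) : Measurable M.clampU :=
  (LipschitzWith.of_dist_le_mul (abs_clampU_sub_le M hK)).continuous.measurable

theorem clampU_mem_Icc (hK : LipschitzOnWith K M.U (Icc 0 (H : ℝ))) (y : ℝ) :
    M.clampU y ∈ Icc 0 ((H : ℝ) * K) := by
  have hH : (0 : ℝ) ≤ H := Nat.cast_nonneg H
  have h0 : (0 : ℝ) ∈ Icc (0 : ℝ) H := ⟨le_rfl, hH⟩
  have h1 := max_min_mem_Icc hH y
  have h2 := M.U_mono.monotoneOn h0 h1 h1.1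
  rw [M.U_zero] at h2
  refine ⟨h2, ?_⟩
  have h3 := hK.dist_le_mul _ h1 _ h0
  rw [Real.dist_eq, Real.dist_eq, M.U_zero, sub_zero, sub_zero, abs_of_nonneg h1.1] at h3
  calc M.clampU y ≤ |M.U (max 0 (min (H : ℝ) y))| := le_abs_self _
    _ ≤ K * max 0 (min (H : ℝ) y) := h3
    _ ≤ K * H := mul_le_mul_of_nonneg_left h1.2 K.2
    _ = H * K := mul_comm _ _

end Clamp

section Value

variable {H : ℕ} {S A : Type*} [Fintype S] [MeasurableSpace S] [MeasurableSingletonClass S]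
  [Fintype A] [MeasurableSpace A] [MeasurableSingletonClass A] (M : RSMDP H S A) (π : Policy H S A)

instance (h : Fin H) : IsMarkovKernel (M.step π h) := by
  refine ⟨fun x => ?_⟩
  change IsProbabilityMeasure (M.trans h x.1 x.2 (π.act h x.1 x.2))
  exact Measure.isProbabilityMeasure_map (by fun_prop)

theorem finalLaw_last : M.finalLaw π (Fin.last H) = Kernel.id := by
  simp only [RSMDP.finalLaw, Fin.reverseInduction_last]

theorem finalLaw_castSucc (h : Fin H) :
    M.finalLaw π h.castSucc = M.finalLaw π h.succ ∘ₖ M.step π h := by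
  simp only [RSMDP.finalLaw, Fin.reverseInduction_castSucc]

instance (h : Fin (H + 1)) : IsMarkovKernel (M.finalLaw π h) := by
  induction h using Fin.reverseInduction with
  | last => rw [finalLaw_last]; infer_instance
  | cast h ih => rw [finalLaw_castSucc]; infer_instance

/-- The value function of `π` for the utility `u`. -/
def RSMDP.utilityValue (u : ℝ → ℝ) (h : Fin (H + 1)) (s : S) (y : ℝ) : ℝ :=
  ∫ x, u x.2 ∂(M.finalLaw π h (s, y))

theorem measurable_utilityValue {u : ℝ → ℝ} (hu : Measurable u) (h : Fin (H + 1)) :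
    Measurable fun x : S × ℝ => M.utilityValue π u h x.1 x.2 :=
  ((hu.comp measurable_snd).stronglyMeasurable.integral_kernel
    (κ := M.finalLaw π h)).measurable

theorem utilityValue_mem_Icc {u : ℝ → ℝ} (hu : Measurable u) {B : ℝ} (hB : ∀ y, u y ∈ Icc 0 B)
    (h : Fin (H + 1)) (s : S) (y : ℝ) : M.utilityValue π u h s y ∈ Icc 0 B :=
  integral_mem_Icc_of_forall (hu.comp measurable_snd) fun _ => hB _

theorem integrable_utilityValue_add {u : ℝ → ℝ} (hu : Measurable u) {B : ℝ}
    (hB : ∀ y, u y ∈ Icc 0 B) (h : Fin (H + 1)) (y : ℝ) (μ : Measure (S × ℝ)) [IsFiniteMeasure μ] :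
    Integrable (fun x : S × ℝ => M.utilityValue π u h x.1 (y + x.2)) μ :=
  Integrable.of_mem_Icc 0 B ((measurable_utilityValue M π hu h).comp
    (measurable_fst.prodMk (measurable_snd.const_add y))).aemeasurable
    (ae_of_all _ fun _ => utilityValue_mem_Icc M π hu hB _ _ _)

theorem utilityValue_last {u : ℝ → ℝ} (hu : Measurable u) (s : S) (y : ℝ) :
    M.utilityValue π u (Fin.last H) s y = u y := by
  rw [RSMDP.utilityValue, finalLaw_last, Kernel.id_apply,
    integral_dirac' (fun x : S × ℝ => u x.2) _ (hu.comp measurable_snd).stronglyMeasurable]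

theorem utilityValue_castSucc {u : ℝ → ℝ} (hu : Measurable u) {B : ℝ} (hB : ∀ y, u y ∈ Icc 0 B)
    (h : Fin H) (s : S) (y : ℝ) :
    M.utilityValue π u h.castSucc s y = ∫ x, M.utilityValue π u h.succ x.1 (y + x.2)
      ∂(M.P h s (π.act h s y)).prod (M.R h s (π.act h s y)) := by
  rw [RSMDP.utilityValue, finalLaw_castSucc, Kernel.integral_comp (f := fun x : S × ℝ => u x.2)
    (Integrable.of_mem_Icc 0 B (hu.comp measurable_snd).aemeasurable (ae_of_all _ fun _ => hB _))]
  change ∫ x, M.utilityValue π u h.succ x.1 x.2 ∂(M.trans h s y (π.act h s y)) = _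
  rw [RSMDP.trans, integral_map (by fun_prop)
    (measurable_utilityValue M π hu h.succ).aestronglyMeasurable]

theorem add_mem_Icc_succ {h : Fin H} {y r : ℝ} (hy : y ∈ Icc (0 : ℝ) (h.castSucc : Fin (H + 1)))
    (hr : r ∈ Icc (0 : ℝ) 1) : y + r ∈ Icc (0 : ℝ) (h.succ : Fin (H + 1)) := by
  simp only [Fin.val_castSucc, Fin.val_succ] at *
  push_cast
  exact ⟨add_nonneg hy.1 hr.1, add_le_add hy.2 hr.2⟩

theorem ae_finalLaw_mem_Icc (h : Fin (H + 1)) (s : S) (y : ℝ) (hy : y ∈ Icc (0 : ℝ) h) :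
    ∀ᵐ x ∂(M.finalLaw π h (s, y)), x.2 ∈ Icc (0 : ℝ) H := by
  have hms : MeasurableSet {x : S × ℝ | x.2 ∈ Icc (0 : ℝ) H} := measurable_snd measurableSet_Icc
  induction h using Fin.reverseInduction generalizing s y with
  | last =>
    rw [finalLaw_last, Kernel.id_apply, ae_dirac_iff hms]
    simpa using hy
  | cast h ih =>
    have hm0 : Measurable (fun x : S × ℝ => M.finalLaw π h.succ x {x : S × ℝ | x.2 ∈ Icc (0 : ℝ) H}ᶜ) :=
      Kernel.measurable_coe _ hms.compl
    rw [ae_iff, finalLaw_castSucc]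
    change (M.finalLaw π h.succ ∘ₖ M.step π h) (s, y) {x : S × ℝ | x.2 ∈ Icc (0 : ℝ) H}ᶜ = 0
    rw [Kernel.comp_apply' _ _ _ hms.compl]
    change ∫⁻ x, _ ∂(M.trans h s y (π.act h s y)) = 0
    have hadd : Measurable fun z : S × ℝ => (z.1, y + z.2) := by fun_prop
    rw [RSMDP.trans, lintegral_map hm0 hadd]
    refine (lintegral_eq_zero_iff (hm0.comp hadd)).2 ?_
    filter_upwards [M.ae_reward_mem_Icc h s (π.act h s y)] with x hx
    exact ae_iff.1 (ih x.1 (y + x.2) (add_mem_Icc_succ hy hx))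

variable {K : ℝ≥0}

theorem value_eq_utilityValue (h : Fin (H + 1)) (s : S) {y : ℝ} (hy : y ∈ Icc (0 : ℝ) h) :
    M.value π h s y = M.utilityValue π M.clampU h s y := by
  refine integral_congr_ae ?_
  filter_upwards [ae_finalLaw_mem_Icc M π h s y hy] with x hx
  exact (clampU_eq M hx).symm

variable [Nonempty A]

theorem utilityValue_le_bellman {u : ℝ → ℝ} {B : ℝ} (hu : Measurable u) (hB : ∀ y, u y ∈ Icc 0 B)
    (hL : ∀ y y', |u y - u y'| ≤ K * |y - y'|) (h : Fin (H + 1)) (s : S) (y : ℝ) :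
    M.utilityValue π u h s y ≤ M.bellman id u h s y := by
  induction h using Fin.reverseInduction generalizing s y with
  | last => rw [bellman_last, utilityValue_last M π hu]
  | cast h ih =>
    rw [utilityValue_castSucc M π hu hB]
    refine le_trans ?_ (backup_le_bellman M u h s y (π.act h s y))
    exact integral_mono (integrable_utilityValue_add M π hu hB _ _ _)
      ((isRegular_bellman M measurable_id hB hL h.succ).integrable_add measurable_id y _)
      fun x => ih _ _

theorem exists_policy_utilityValue_eq_bellman {u : ℝ → ℝ} {B : ℝ} (hu : Measurable u)
    (hB : ∀ y, u y ∈ Icc 0 B) (hL : ∀ y y', |u y - u y'| ≤ K * |y - y'|) :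
    ∃ πs : Policy H S A, ∀ h s y, M.utilityValue πs u h s y = M.bellman id u h s y := by
  have hr := isRegular_bellman M measurable_id hB hL
  choose g hgm hg using fun (h : Fin H) (s : S) => exists_measurable_argmax
    (fun y a => M.backup id h (M.bellman id u h.succ) s y a) fun a =>
      (LipschitzWith.of_dist_le_mul (fun y y' =>
        abs_backup_sub_backup_le M measurable_id (hr h.succ) h s y y' a)).continuous.measurable
  refine ⟨⟨g, hgm⟩, fun h => ?_⟩
  induction h using Fin.reverseInduction with
  | last => intro s y; rw [bellman_last, utilityValue_last M _ hu]
  | cast h ih =>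
    intro s y
    rw [utilityValue_castSucc M _ hu hB]
    simp only [ih]
    exact le_antisymm (backup_le_bellman M u h s y (g h s y))
      ((bellman_castSucc M u h s y).trans_le (Finset.sup'_le _ _ fun a _ => hg h s y a))

/-- An optimal policy exists, and its value function is given by value iteration. -/
theorem exists_isOptimal (hK : LipschitzOnWith K M.U (Icc 0 (H : ℝ))) :
    ∃ πs : Policy H S A, M.IsOptimal πs ∧ ∀ h : Fin H, ∀ s : S, ∀ y ∈ Icc (0 : ℝ) (h : ℝ),
      M.value πs h.castSucc s y = M.bellman id M.clampU h.castSucc s y := by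
  obtain ⟨πs, hπs⟩ := exists_policy_utilityValue_eq_bellman M (measurable_clampU M hK)
    (clampU_mem_Icc M hK) (abs_clampU_sub_le M hK)
  have h1 : ∀ h : Fin H, ∀ s : S, ∀ y ∈ Icc (0 : ℝ) (h : ℝ),
      M.value πs h.castSucc s y = M.bellman id M.clampU h.castSucc s y := fun h s y hy => by
    rw [value_eq_utilityValue M πs h.castSucc s hy, hπs]
  refine ⟨πs, fun π' h s y hy => ?_, h1⟩
  rw [h1 h s y hy, value_eq_utilityValue M π' h.castSucc s hy]
  exact utilityValue_le_bellman M π' (measurable_clampU M hK) (clampU_mem_Icc M hK)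
    (abs_clampU_sub_le M hK) _ _ _

end Value

section Empirical

theorem sum_card_filter_div_mul {β : Type*} [DecidableEq β] {n : ℕ} (g : Fin n → β) (t : Finset β)
    (hg : ∀ i, g i ∈ t) (ψ : β → ℝ) :
    ∑ r ∈ t, ((Finset.univ.filter fun i => g i = r).card : ℝ) / n * ψ r = (∑ i, ψ (g i)) / n := by
  rw [← Finset.sum_fiberwise_of_maps_to (s := Finset.univ) (t := t) (g := g) fun i _ => hg i,
    Finset.sum_div]
  refine Finset.sum_congr rfl fun r _ => ?_
  rw [Finset.sum_congr rfl (g := fun _ => ψ r) fun i hi => by rw [(Finset.mem_filter.1 hi).2],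
    Finset.sum_const, nsmul_eq_mul]
  ring

theorem abs_mean_sub_mean_le {n : ℕ} (hn : 0 < n) {f g : Fin n → ℝ} {c : ℝ}
    (h : ∀ i, |f i - g i| ≤ c) : |(∑ i, f i) / n - (∑ i, g i) / n| ≤ c := by
  have hn' : (0 : ℝ) < n := Nat.cast_pos.2 hn
  rw [← sub_div, ← Finset.sum_sub_distrib, abs_div, abs_of_pos hn', div_le_iff₀ hn']
  refine (Finset.abs_sum_le_sum_abs _ _).trans ((Finset.sum_le_sum fun i _ => h i).trans_eq ?_)
  simp [mul_comm]

variable {H : ℕ} {S A : Type*} [Fintype S] {n : ℕ}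

theorem hatBackup_eq_mean (e : ℝ) (D : Data H S A n) (h : Fin H) (V : S → ℝ → ℝ) (s : S) (y : ℝ)
    (a : A) : hatBackup e D h V s y a =
      (∑ j, (∑ i, V (D (h, s, a, j)).1 (y + gridProj e 1 (D (h, s, a, i)).2)) / n) / n := by
  classical
  have h1 : ∀ s', ∑ r ∈ grid e 1, hatR e D h s a r * V s' (y + r) =
      (∑ i, V s' (y + gridProj e 1 (D (h, s, a, i)).2)) / n := fun s' => by
    rw [← sum_card_filter_div_mul _ (grid e 1) (fun i => gridProj_mem_grid e 1 (D (h, s, a, i)).2)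
      fun r => V s' (y + r)]
    refine Finset.sum_congr rfl fun r _ => ?_
    unfold hatR
    congr!
  rw [← sum_card_filter_div_mul (fun j => (D (h, s, a, j)).1) Finset.univ
    (fun _ => Finset.mem_univ _)
    fun s' => (∑ i, V s' (y + gridProj e 1 (D (h, s, a, i)).2)) / (n : ℝ)]
  refine Finset.sum_congr rfl fun s' _ => ?_
  rw [← h1, Finset.mul_sum]
  refine Finset.sum_congr rfl fun r _ => ?_
  rw [mul_assoc]
  unfold hatP
  congr!

theorem abs_hatBackup_sub_hatBackup_le (hn : 0 < n) (e : ℝ) (D : Data H S A n) (h : Fin H)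
    {V V' : S → ℝ → ℝ} {y c : ℝ} (hc : ∀ s', ∀ r ∈ grid e 1, |V s' (y + r) - V' s' (y + r)| ≤ c)
    (s : S) (a : A) : |hatBackup e D h V s y a - hatBackup e D h V' s y a| ≤ c := by
  rw [hatBackup_eq_mean, hatBackup_eq_mean]
  exact abs_mean_sub_mean_le hn fun j => abs_mean_sub_mean_le hn fun i =>
    hc _ _ (gridProj_mem_grid _ _ _)

variable [MeasurableSpace S] [MeasurableSingletonClass S] (M : RSMDP H S A)

/-- The functions whose empirical means control the empirical backup: the expectation over the
reward as a function of the next state, and, for each next state, the value as a function of the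
reward. -/
def RSMDP.testFun (ρ : ℝ → ℝ) (h : Fin H) (V : S → ℝ → ℝ) (s : S) (y : ℝ) (a : A) :
    Option S → S × ℝ → ℝ
  | none => fun x => ∫ r, V x.1 (y + ρ r) ∂M.R h s a
  | some s' => fun x => V s' (y + ρ x.2)

variable {ρ : ℝ → ℝ} {K : ℝ≥0} {B : ℝ} {V : S → ℝ → ℝ}

theorem measurable_testFun (hρ : Measurable ρ) (hV : IsRegular K B V) (h : Fin H) (s : S) (y : ℝ)
    (a : A) (o : Option S) : Measurable (M.testFun ρ h V s y a o) := by
  cases o with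
  | none =>
    exact (measurable_of_countable fun s' => ∫ r, V s' (y + ρ r) ∂M.R h s a).comp measurable_fst
  | some s' =>
    exact hV.measurable.comp (measurable_const.prodMk ((hρ.comp measurable_snd).const_add y))

theorem testFun_mem_Icc (hρ : Measurable ρ) (hV : IsRegular K B V) (h : Fin H) (s : S) (y : ℝ)
    (a : A) (o : Option S) (x : S × ℝ) : M.testFun ρ h V s y a o x ∈ Icc 0 B := by
  cases o with
  | none =>
    exact integral_mem_Icc_of_forall
      (hV.measurable.comp (measurable_const.prodMk (hρ.const_add y))) fun _ => hV.mem_Icc _ _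
  | some s' => exact hV.mem_Icc _ _

theorem integral_testFun_none (hρ : Measurable ρ) (hV : IsRegular K B V) (h : Fin H) (s : S) (y : ℝ)
    (a : A) : ∫ x, M.testFun ρ h V s y a none x ∂(M.P h s a).prod (M.R h s a) =
      M.backup ρ h V s y a := by
  have h1 := integral_fun_fst (μ := M.P h s a) (ν := M.R h s a)
    fun s' => ∫ r, V s' (y + ρ r) ∂M.R h s a
  rw [probReal_univ, one_smul] at h1
  exact h1.trans (integral_prod _ (hV.integrable_add hρ y _)).symm

theorem integral_testFun_some (h : Fin H) (s : S) (y : ℝ) (a : A) (s' : S) :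
    ∫ x, M.testFun ρ h V s y a (some s') x ∂(M.P h s a).prod (M.R h s a) =
      ∫ r, V s' (y + ρ r) ∂M.R h s a := by
  have h1 := integral_fun_snd (μ := M.P h s a) (ν := M.R h s a) fun r => V s' (y + ρ r)
  rwa [probReal_univ, one_smul] at h1

theorem abs_hatBackup_sub_backup_le (hn : 0 < n) {e δ : ℝ} (hV : IsRegular K B V)
    (D : Data H S A n) (h : Fin H) (s : S) (y : ℝ) (a : A)
    (hδ : ∀ o, |(∑ i, M.testFun (gridProj e 1) h V s y a o (D (h, s, a, i))) / n -
      ∫ x, M.testFun (gridProj e 1) h V s y a o x ∂(M.P h s a).prod (M.R h s a)| ≤ δ) :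
    |hatBackup e D h V s y a - M.backup (gridProj e 1) h V s y a| ≤ 2 * δ := by
  rw [hatBackup_eq_mean]
  have h0 := hδ none
  rw [integral_testFun_none M (measurable_gridProj e 1) hV] at h0
  have h1 : |(∑ j, (∑ i, V (D (h, s, a, j)).1 (y + gridProj e 1 (D (h, s, a, i)).2)) / n) / n -
      (∑ i, M.testFun (gridProj e 1) h V s y a none (D (h, s, a, i))) / n| ≤ δ := by
    refine abs_mean_sub_mean_le hn fun j => ?_
    have h2 := hδ (some (D (h, s, a, j)).1)
    rwa [integral_testFun_some M] at h2
  exact (abs_sub_le _ _ _).trans (by linarith)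

/-- The event that all empirical means that matter for value iteration on the nets deviate by less
than `δ`. -/
def RSMDP.goodEvent [Fintype A] [Nonempty A] (n : ℕ) (e δ : ℝ) : Set (Data H S A n) :=
  {D | ∀ (h : Fin H) (s : S) (a : A) (o : Option S), ∀ y ∈ grid e ((H : ℝ) - 1),
    |(∑ i, M.testFun (gridProj e 1) h (M.bellman (gridProj e 1) M.clampU h.succ) s y a o
        (D (h, s, a, i))) / n -
      ∫ x, M.testFun (gridProj e 1) h (M.bellman (gridProj e 1) M.clampU h.succ) s y a o x
        ∂(M.P h s a).prod (M.R h s a)| < δ}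

variable [Fintype A] [Nonempty A]

theorem dataLaw_compl_goodEvent_le (hn : 0 < n) (hH : 0 < H)
    (hK : LipschitzOnWith K M.U (Icc 0 (H : ℝ))) {e δ : ℝ} (he : 0 < e) (he1 : e ≤ 1)
    (hδ : 0 ≤ δ) :
    (M.dataLaw n).real (M.goodEvent n e δ)ᶜ ≤
      H * Fintype.card S * Fintype.card A * (Fintype.card S + 1) * (H / e) *
        (2 * Real.exp (-2 * n * δ ^ 2 / (H * K) ^ 2)) := by
  have hr := isRegular_bellman M (measurable_gridProj e 1) (clampU_mem_Icc M hK)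
    (abs_clampU_sub_le M hK)
  let E : Fin H × S × A × Option S × grid e ((H : ℝ) - 1) → Set (Data H S A n) := fun q =>
    {D | δ ≤ |(∑ i, M.testFun (gridProj e 1) q.1 (M.bellman (gridProj e 1) M.clampU q.1.succ) q.2.1
          q.2.2.2.2 q.2.2.1 q.2.2.2.1 (D (q.1, q.2.1, q.2.2.1, i))) / n -
        ∫ x, M.testFun (gridProj e 1) q.1 (M.bellman (gridProj e 1) M.clampU q.1.succ) q.2.1
          q.2.2.2.2 q.2.2.1 q.2.2.2.1 x ∂(M.P q.1 q.2.1 q.2.2.1).prod (M.R q.1 q.2.1 q.2.2.1)|}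
  have hsub : (M.goodEvent n e δ)ᶜ ⊆ ⋃ q, E q := by
    intro D hD
    simp only [RSMDP.goodEvent, mem_compl_iff, mem_ofPred_eq, not_forall, not_lt] at hD
    obtain ⟨h, s, a, o, y, hy, hD⟩ := hD
    exact mem_iUnion.2 ⟨(h, s, a, o, ⟨y, hy⟩), hD⟩
  have hE : ∀ q, (M.dataLaw n).real (E q) ≤ 2 * Real.exp (-2 * n * δ ^ 2 / (H * K) ^ 2) :=
    fun q => measureReal_mean_deviation_le M hn _ _ _
      (measurable_testFun M (measurable_gridProj e 1) (hr _) _ _ _ _ _)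
      (testFun_mem_Icc M (measurable_gridProj e 1) (hr _) _ _ _ _ _) hδ
  have hcard : ((grid e ((H : ℝ) - 1)).card : ℝ) ≤ H / e := by
    have hH1 : (1 : ℝ) ≤ H := by exact_mod_cast hH
    refine (card_grid_le he (by linarith)).trans ?_
    rw [sub_div]
    have := (one_le_div he).2 he1
    linarith
  refine (measureReal_mono hsub).trans ((measureReal_iUnion_fintype_le _).trans
    ((Finset.sum_le_sum fun q _ => hE q).trans ?_))
  rw [Finset.sum_const, nsmul_eq_mul]
  refine mul_le_mul_of_nonneg_right ?_ (by positivity)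
  simp only [Finset.card_univ, Fintype.card_prod, Fintype.card_fin, Fintype.card_option,
    Fintype.card_coe]
  push_cast
  calc (H : ℝ) * (Fintype.card S * (Fintype.card A * ((Fintype.card S + 1) *
        (grid e ((H : ℝ) - 1)).card)))
      = H * Fintype.card S * Fintype.card A * (Fintype.card S + 1) *
        (grid e ((H : ℝ) - 1)).card := by ring
    _ ≤ _ := mul_le_mul_of_nonneg_left hcard (by positivity)

theorem hatV_last (U : ℝ → ℝ) (e : ℝ) (D : Data H S A n) (s : S) (y : ℝ) :
    hatV U e D (Fin.last H) s y = U y := by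
  simp only [hatV, Fin.reverseInduction_last]

theorem hatV_castSucc (U : ℝ → ℝ) (e : ℝ) (D : Data H S A n) (h : Fin H) (s : S) (y : ℝ) :
    hatV U e D h.castSucc s y =
      Finset.univ.sup' Finset.univ_nonempty fun a => hatQ U e D h s y a := by
  simp only [hatV, hatQ, Fin.reverseInduction_castSucc]

theorem abs_hatQ_sub_backup_le (hn : 0 < n) (hK : LipschitzOnWith K M.U (Icc 0 (H : ℝ)))
    {e δ : ℝ} (he : 0 < e) {D : Data H S A n} (hD : D ∈ M.goodEvent n e δ) (h : Fin H)
    {c : ℝ} (hc : ∀ s', ∀ y ∈ grid e ((h : ℝ) + 1),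
      |hatV M.U e D h.succ s' y - M.bellman (gridProj e 1) M.clampU h.succ s' y| ≤ c)
    (s : S) {y : ℝ} (hy : y ∈ grid e (h : ℝ)) (a : A) :
    |hatQ M.U e D h s y a -
      M.backup (gridProj e 1) h (M.bellman (gridProj e 1) M.clampU h.succ) s y a| ≤ c + 2 * δ := by
  have hr := isRegular_bellman M (measurable_gridProj e 1) (clampU_mem_Icc M hK)
    (abs_clampU_sub_le M hK) h.succ
  have hhH : (h : ℝ) ≤ H - 1 := by
    have : (h : ℝ) + 1 ≤ H := by exact_mod_cast h.2
    linarith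
  have h1 := abs_hatBackup_sub_hatBackup_le hn e D h (y := y)
    (fun s' r hr => hc s' (y + r) (add_mem_grid he (Nat.cast_nonneg _) zero_le_one hy hr)) s a
  have h2 := abs_hatBackup_sub_backup_le M hn hr D h s y a
    fun o => (hD h s a o y (grid_mono he hhH hy)).le
  exact (abs_sub_le _ _ _).trans (add_le_add h1 h2)

theorem abs_hatV_sub_bellman_le (hn : 0 < n) (hK : LipschitzOnWith K M.U (Icc 0 (H : ℝ)))
    {e δ : ℝ} (he : 0 < e) {D : Data H S A n} (hD : D ∈ M.goodEvent n e δ) (h : Fin (H + 1))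
    (s : S) (y : ℝ) (hy : y ∈ grid e (h : ℝ)) :
    |hatV M.U e D h s y - M.bellman (gridProj e 1) M.clampU h s y| ≤ ((H : ℝ) - h) * (2 * δ) := by
  induction h using Fin.reverseInduction generalizing s y with
  | last =>
    rw [hatV_last, bellman_last, clampU_eq M]
    · simp
    · simpa using mem_Icc_of_mem_grid he (Nat.cast_nonneg _) hy
  | cast h ih =>
    rw [hatV_castSucc, bellman_castSucc]
    refine abs_sup'_sub_sup'_le _ fun a _ => ?_
    refine (abs_hatQ_sub_backup_le M hn hK he hD h (c := ((H : ℝ) - (h.succ : Fin (H + 1))) * (2 * δ))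
      (fun s' y hy => ih s' y ?_) s hy a).trans_eq ?_
    · simpa using hy
    · simp only [Fin.val_succ, Fin.val_castSucc]
      push_cast
      ring

/-- On the good event, greedy actions for the estimated Q function are nearly greedy for the
Q function of the process with projected rewards. -/
theorem bellman_sub_backup_greedy_le (hn : 0 < n) (hK : LipschitzOnWith K M.U (Icc 0 (H : ℝ)))
    {e δ : ℝ} (he : 0 < e) (hδ : 0 ≤ δ) {D : Data H S A n} (hD : D ∈ M.goodEvent n e δ) (h : Fin H)
    (s : S) {y : ℝ} (hy : y ∈ grid e (h : ℝ)) {b : A}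
    (hb : ∀ a, hatQ M.U e D h s y a ≤ hatQ M.U e D h s y b) :
    M.bellman (gridProj e 1) M.clampU h.castSucc s y -
      M.backup (gridProj e 1) h (M.bellman (gridProj e 1) M.clampU h.succ) s y b ≤
      4 * H * δ := by
  have hQ : ∀ a, |hatQ M.U e D h s y a -
      M.backup (gridProj e 1) h (M.bellman (gridProj e 1) M.clampU h.succ) s y a| ≤
        2 * H * δ := fun a => by
    refine (abs_hatQ_sub_backup_le M hn hK he hD h (c := ((H : ℝ) - (h.succ : Fin (H + 1))) * (2 * δ))
      (fun s' y hy => abs_hatV_sub_bellman_le M hn hK he hD h.succ s' y ?_) s hy a).trans ?_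
    · simpa using hy
    · simp only [Fin.val_succ]
      push_cast
      have : 0 ≤ (h : ℝ) * δ := mul_nonneg (Nat.cast_nonneg _) hδ
      linarith
  rw [sub_le_iff_le_add, bellman_castSucc]
  refine Finset.sup'_le _ _ fun a _ => ?_
  have h1 := (abs_le.1 (hQ a)).1
  have h2 := (abs_le.1 (hQ b)).2
  have h3 := hb a
  linarith

end Empirical

section Simulation

variable {H : ℕ} {S A : Type*} [Fintype S] [MeasurableSpace S] [MeasurableSingletonClass S]
  [Fintype A] [MeasurableSpace A] [MeasurableSingletonClass A] [Nonempty A] (M : RSMDP H S A)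
  {K : ℝ≥0} {B : ℝ}

/-- The interpolation of a policy on the nets that is greedy up to `η` for the process with
projected rewards loses at most `3 * K * e + η` per remaining step. -/
theorem abs_bellman_sub_utilityValue_interpolate_le {u : ℝ → ℝ} (hu : ∀ y, u y ∈ Icc 0 B)
    (hL : ∀ y y', |u y - u y'| ≤ K * |y - y'|) {e η : ℝ} (he : 0 < e) {g : Fin H → S → ℝ → A}
    (hg : ∀ h : Fin H, ∀ s : S, ∀ y ∈ grid e (h : ℝ),
      M.bellman (gridProj e 1) u h.castSucc s y -
        M.backup (gridProj e 1) h (M.bellman (gridProj e 1) u h.succ) s y (g h s y) ≤ η)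
    (h : Fin (H + 1)) (s : S) (y : ℝ) (hy : y ∈ Icc (0 : ℝ) h) :
    |M.bellman (gridProj e 1) u h s y - M.utilityValue (interpolate e g) u h s y| ≤
      ((H : ℝ) - h) * (3 * (K * e) + η) := by
  have hum : Measurable u := (LipschitzWith.of_dist_le_mul hL).continuous.measurable
  have hr := isRegular_bellman M (measurable_gridProj e 1) hu hL
  induction h using Fin.reverseInduction generalizing s y with
  | last => simp [bellman_last, utilityValue_last M _ hum]
  | cast h ih =>
    set y' := gridProj e (h : ℝ) y with hy'
    have hyy' : |y - y'| ≤ e := abs_sub_gridProj_le he hy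
    set a := g h s y' with ha
    have h1 : |M.bellman (gridProj e 1) u h.castSucc s y -
        M.bellman (gridProj e 1) u h.castSucc s y'| ≤ K * e :=
      ((hr h.castSucc).lipschitz s y y').trans (mul_le_mul_of_nonneg_left hyy' K.2)
    have h2 : |M.bellman (gridProj e 1) u h.castSucc s y' -
        M.backup (gridProj e 1) h (M.bellman (gridProj e 1) u h.succ) s y' a| ≤ η := by
      rw [abs_of_nonneg (sub_nonneg.2 (backup_le_bellman M u h s y' a))]
      exact hg h s y' (gridProj_mem_grid _ _ _)
    have h3 : |M.backup (gridProj e 1) h (M.bellman (gridProj e 1) u h.succ) s y' a -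
        M.utilityValue (interpolate e g) u h.castSucc s y| ≤
          2 * (K * e) + ((H : ℝ) - (h.succ : Fin (H + 1))) * (3 * (K * e) + η) := by
      rw [utilityValue_castSucc M _ hum hu]
      refine abs_integral_sub_integral_le
        ((hr h.succ).integrable_add (measurable_gridProj e 1) y' _)
        (integrable_utilityValue_add M _ hum hu _ _ _) ?_
      filter_upwards [M.ae_reward_mem_Icc h s a] with x hx
      have h4 := (hr h.succ).lipschitz x.1 (y' + gridProj e 1 x.2) (y + x.2)
      have h5 : |y' + gridProj e 1 x.2 - (y + x.2)| ≤ 2 * e := by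
        have h6 := abs_sub_gridProj_le he hx
        rw [abs_le] at h6 hyy' ⊢
        constructor <;> linarith
      have h7 := mul_le_mul_of_nonneg_left h5 K.2
      rw [NNReal.val_eq_coe] at h7
      have h8 := ih x.1 (y + x.2) (add_mem_Icc_succ hy hx)
      exact (abs_sub_le _ (M.bellman (gridProj e 1) u h.succ x.1 (y + x.2)) _).trans
        (by linarith)
    have h9 := abs_sub_le (M.bellman (gridProj e 1) u h.castSucc s y)
      (M.bellman (gridProj e 1) u h.castSucc s y') (M.utilityValue (interpolate e g) u h.castSucc s y)
    have h10 := abs_sub_le (M.bellman (gridProj e 1) u h.castSucc s y')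
      (M.backup (gridProj e 1) h (M.bellman (gridProj e 1) u h.succ) s y' a)
      (M.utilityValue (interpolate e g) u h.castSucc s y)
    simp only [Fin.val_succ, Fin.val_castSucc] at *
    push_cast at *
    linarith

/-- Outputs of the algorithm on the good event are nearly optimal. -/
theorem isEpsOptimal_of_mem_goodEvent {n : ℕ} (hn : 0 < n)
    (hK : LipschitzOnWith K M.U (Icc 0 (H : ℝ))) {e δ ε : ℝ} (he : 0 < e) (hδ : 0 ≤ δ)
    (hε : H * (4 * (K * e) + 4 * H * δ) ≤ ε) {D : Data H S A n} (hD : D ∈ M.goodEvent n e δ)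
    {π : Policy H S A} (hπ : IsOutput M.U e D π) : M.IsEpsOptimal ε π := by
  obtain ⟨πs, hopt, hval⟩ := exists_isOptimal M hK
  refine ⟨πs, hopt, fun h s y hy => ?_⟩
  obtain ⟨g, hg, rfl⟩ := hπ
  rw [hval h s y hy, value_eq_utilityValue M _ h.castSucc s hy]
  have h1 := abs_bellman_id_sub_bellman_le M (measurable_gridProj e 1) (clampU_mem_Icc M hK)
    (abs_clampU_sub_le M hK) (fun r hr => abs_sub_gridProj_le he hr) h.castSucc s y
  have h2 := abs_bellman_sub_utilityValue_interpolate_le M (clampU_mem_Icc M hK)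
    (abs_clampU_sub_le M hK) he
    (fun h s y hy => bellman_sub_backup_greedy_le M hn hK he hδ hD h s hy (hg h s y hy))
    h.castSucc s y hy
  refine (abs_sub_le _ _ _).trans ((add_le_add h1 h2).trans (le_trans ?_ hε))
  have h3 : 0 ≤ (h : ℝ) * (4 * (K * e) + 4 * H * δ) := by positivity
  simp only [Fin.val_castSucc]
  linarith

/-- Every policy is `H * K`-optimal. -/
theorem isEpsOptimal_of_le (hK : LipschitzOnWith K M.U (Icc 0 (H : ℝ))) {ε : ℝ} (hε : H * K ≤ ε)
    (π : Policy H S A) : M.IsEpsOptimal ε π := by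
  obtain ⟨πs, hopt, -⟩ := exists_isOptimal M hK
  refine ⟨πs, hopt, fun h s y hy => ?_⟩
  rw [value_eq_utilityValue M πs h.castSucc s hy, value_eq_utilityValue M π h.castSucc s hy]
  have h1 := utilityValue_mem_Icc M πs (measurable_clampU M hK) (clampU_mem_Icc M hK) h.castSucc s y
  have h2 := utilityValue_mem_Icc M π (measurable_clampU M hK) (clampU_mem_Icc M hK) h.castSucc s y
  rw [abs_le]
  constructor <;> linarith [h1.1, h1.2, h2.1, h2.2]

theorem succeeds_of_goodEvent {n : ℕ} (hn : 0 < n) (hK : LipschitzOnWith K M.U (Icc 0 (H : ℝ)))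
    {e δ ε p : ℝ} (he : 0 < e) (hδ : 0 ≤ δ) (hε : H * (4 * (K * e) + 4 * H * δ) ≤ ε) (hp : 0 ≤ p)
    (hprob : (M.dataLaw n).real (M.goodEvent n e δ)ᶜ ≤ p) : M.Succeeds e ε p n := by
  have h1 : M.dataLaw n (M.goodEvent n e δ)ᶜ ≤ ENNReal.ofReal p := by
    rw [← ofReal_measureReal]
    exact ENNReal.ofReal_le_ofReal hprob
  have h2 : M.goodEvent n e δ ⊆ {D | ∀ π : Policy H S A, IsOutput M.U e D π → M.IsEpsOptimal ε π} :=
    fun D hD π hπ => isEpsOptimal_of_mem_goodEvent M hn hK he hδ hε hD hπ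
  rw [RSMDP.Succeeds, ENNReal.ofReal_sub _ hp, ENNReal.ofReal_one, tsub_le_iff_left]
  calc (1 : ℝ≥0∞) = M.dataLaw n univ := measure_univ.symm
    _ = M.dataLaw n ((M.goodEvent n e δ)ᶜ ∪ M.goodEvent n e δ) := by rw [compl_union_self]
    _ ≤ _ := (measure_union_le _ _).trans (add_le_add h1 (measure_mono h2))

end Simulation

section Rates

variable {H : ℕ} {S A : Type*} [Fintype S] [Nonempty S] [MeasurableSpace S]
  [MeasurableSingletonClass S] [Fintype A] [Nonempty A] [MeasurableSpace A]
  [MeasurableSingletonClass A] (M : RSMDP H S A) {K : ℝ≥0}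

theorem lipschitz_const_pos (hH : 0 < H) (hK : LipschitzOnWith K M.U (Icc 0 (H : ℝ))) :
    (0 : ℝ) < K := by
  have hH' : (0 : ℝ) < H := Nat.cast_pos.2 hH
  have h1 := clampU_mem_Icc M hK H
  rw [clampU_eq M ⟨hH'.le, le_rfl⟩] at h1
  have h2 := M.U_mono ⟨le_rfl, hH'.le⟩ ⟨hH'.le, le_rfl⟩ hH'
  rw [M.U_zero] at h2
  exact pos_of_mul_pos_right (h2.trans_le h1.2) hH'.le

theorem succeeds_of_le {n : ℕ} (hn : 0 < n) (hH : 0 < H)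
    (hK : LipschitzOnWith K M.U (Icc 0 (H : ℝ))) {e ε p : ℝ} (hε : 0 < ε) (hp : 0 < p) (hp1 : p < 1)
    (he : 0 < e) (heε : e ≤ 1 / 8 * (ε / (H * K)))
    (hnl : 64 * ((H : ℝ) ^ 6 * (K : ℝ) ^ 2 * iota H S A p e / ε ^ 2) ≤ n) :
    M.Succeeds e ε p n := by
  have hH1 : (1 : ℝ) ≤ H := by exact_mod_cast hH
  have hH0 : (0 : ℝ) < H := by linarith
  have hK0 := lipschitz_const_pos M hH hK
  have hHK : (0 : ℝ) < H * K := mul_pos hH0 hK0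
  rcases le_or_gt ((H : ℝ) * K) ε with hεK | hεK
  · have : {D : Data H S A n | ∀ π : Policy H S A, IsOutput M.U e D π → M.IsEpsOptimal ε π} =
        univ := eq_univ_of_forall fun D π _ => isEpsOptimal_of_le M hK hεK π
    rw [RSMDP.Succeeds, this, measure_univ, ENNReal.ofReal_le_one]
    linarith
  have hS : (1 : ℝ) ≤ Fintype.card S := by exact_mod_cast Fintype.card_pos
  have hA : (1 : ℝ) ≤ Fintype.card A := by exact_mod_cast Fintype.card_pos
  have he1 : e ≤ 1 := by
    have := (div_lt_one hHK).2 hεK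
    linarith
  have heε' : (H * K) * e ≤ ε / 8 := by
    have h1 := mul_le_mul_of_nonneg_left heε hHK.le
    rwa [show (H * K : ℝ) * (1 / 8 * (ε / (H * K))) = ε / 8 by field_simp] at h1
  refine succeeds_of_goodEvent M hn hK (δ := ε / (8 * H ^ 2)) he (by positivity) ?_ hp.le
    ((dataLaw_compl_goodEvent_le M hn hH hK he he1 (by positivity)).trans ?_)
  · have : (H : ℝ) * (4 * H * (ε / (8 * H ^ 2))) = ε / 2 := by field_simp; norm_num
    linarith
  set s : ℝ := (Fintype.card S : ℝ)
  set c : ℝ := (Fintype.card A : ℝ)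
  set X : ℝ := 4 * (H : ℝ) ^ 2 * s * c / (p * e) with hX
  have hX0 : 0 < X := by positivity
  have hexp : Real.exp (-2 * n * (ε / (8 * H ^ 2)) ^ 2 / (H * K) ^ 2) ≤ (X ^ 2)⁻¹ := by
    rw [← Real.exp_log (inv_pos.2 (pow_pos hX0 2)), Real.exp_le_exp, Real.log_inv, Real.log_pow]
    have h1 : iota H S A p e = Real.log X := rfl
    rw [h1] at hnl
    push_cast
    have h2 : -2 * (n : ℝ) * (ε / (8 * H ^ 2)) ^ 2 / (H * K) ^ 2 =
        - (n * (ε ^ 2 / (32 * H ^ 6 * K ^ 2))) := by field_simp; norm_num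
    rw [h2, neg_le_neg_iff]
    refine le_trans (le_of_eq ?_) (mul_le_mul_of_nonneg_right hnl (by positivity))
    field_simp
    ring
  calc H * s * c * (s + 1) * (H / e) * (2 * Real.exp (-2 * n * (ε / (8 * H ^ 2)) ^ 2 / (H * K) ^ 2))
      ≤ H * s * c * (2 * s) * (H / e) * (2 * (X ^ 2)⁻¹) := by
        gcongr
        linarith
    _ = p * (p * e / (4 * (H ^ 2 * c))) := by rw [hX]; field_simp; norm_num
    _ ≤ p * 1 := by
        refine mul_le_mul_of_nonneg_left ?_ hp.le
        rw [div_le_one (by positivity)]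
        have h3 : p * e ≤ 1 := mul_le_one₀ hp1.le he.le he1
        have h4 : 1 ≤ (H : ℝ) ^ 2 * c := one_le_mul_of_one_le_of_one_le (one_le_pow₀ hH1) hA
        linarith
    _ = p := mul_one p

theorem numSamples_le {n : ℕ} {C y ε : ℝ}
    (h : (n : ℝ) ≤ C * ((H : ℝ) ^ 6 * (K : ℝ) ^ 2 * y / ε ^ 2)) :
    (numSamples H S A n : ℝ) ≤
      C * ((H : ℝ) ^ 7 * Fintype.card S * Fintype.card A * (K : ℝ) ^ 2 * y / ε ^ 2) := by
  simp only [numSamples, Fintype.card_prod, Fintype.card_fin]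
  push_cast
  calc (H : ℝ) * (Fintype.card S * (Fintype.card A * n)) = H * Fintype.card S * Fintype.card A * n := by
        ring
    _ ≤ H * Fintype.card S * Fintype.card A * (C * ((H : ℝ) ^ 6 * (K : ℝ) ^ 2 * y / ε ^ 2)) :=
        mul_le_mul_of_nonneg_left h (by positivity)
    _ = _ := by ring

theorem one_le_rate (hH : 0 < H) {e ε p : ℝ} (hε : 0 < ε) (hp : 0 < p) (hp1 : p < 1)
    (he : 0 < e) (he1 : e ≤ 1) (hεK : ε ≤ H * K) :
    1 ≤ (H : ℝ) ^ 6 * (K : ℝ) ^ 2 * iota H S A p e / ε ^ 2 := by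
  have hH1 : (1 : ℝ) ≤ H := by exact_mod_cast hH
  have hS : (1 : ℝ) ≤ Fintype.card S := by exact_mod_cast Fintype.card_pos
  have hA : (1 : ℝ) ≤ Fintype.card A := by exact_mod_cast Fintype.card_pos
  have hι : 1 ≤ iota H S A p e := by
    rw [iota, Real.le_log_iff_exp_le (by positivity), le_div_iff₀ (by positivity)]
    have h1 : p * e ≤ 1 := mul_le_one₀ hp1.le he.le he1
    have h2 : 1 ≤ (H : ℝ) ^ 2 * Fintype.card S * Fintype.card A :=
      one_le_mul_of_one_le_of_one_le
        (one_le_mul_of_one_le_of_one_le (one_le_pow₀ hH1) hS) hA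
    have h3 := Real.exp_one_lt_d9
    have h4 : Real.exp 1 * (p * e) ≤ Real.exp 1 * 1 :=
      mul_le_mul_of_nonneg_left h1 (Real.exp_pos 1).le
    linarith
  rw [one_le_div (by positivity)]
  calc ε ^ 2 ≤ (H * K) ^ 2 := pow_le_pow_left₀ hε.le hεK 2
    _ = H ^ 2 * K ^ 2 * 1 := by ring
    _ ≤ H ^ 6 * K ^ 2 * iota H S A p e := by
        gcongr ?_ * _ * ?_
        exact pow_le_pow_right₀ hH1 (by norm_num)

end Rates

end VIGU

end

theorem corollary1 :
    ∃ c₀ C₀ C₁ : ℝ, 0 < c₀ ∧ 0 < C₀ ∧ C₀ ≤ C₁ ∧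
      ∀ (H : ℕ) (S A : Type*)
        [Fintype S] [Nonempty S] [MeasurableSpace S] [MeasurableSingletonClass S]
        [Fintype A] [Nonempty A] [MeasurableSpace A] [MeasurableSingletonClass A]
        (M : VIGU.RSMDP H S A) (κ : ℝ≥0) (ε p ε₀ : ℝ),
        0 < H → LipschitzOnWith κ M.U (Set.Icc 0 (H : ℝ)) →
        0 < ε → 0 < p → p < 1 → 0 < ε₀ → ε₀ ≤ c₀ * (ε / (H * κ)) →
        (∀ n : ℕ, 0 < n →
          C₀ * ((H : ℝ) ^ 6 * (κ : ℝ) ^ 2 * VIGU.iota H S A p ε₀ / ε ^ 2) ≤ n →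
          M.Succeeds ε₀ ε p n ∧
          ∀ C : ℝ, n ≤ C * ((H : ℝ) ^ 6 * (κ : ℝ) ^ 2 * VIGU.iota H S A p ε₀ / ε ^ 2) →
            (VIGU.numSamples H S A n : ℝ) ≤
              C * ((H : ℝ) ^ 7 * Fintype.card S * Fintype.card A * (κ : ℝ) ^ 2
                * VIGU.iota H S A p ε₀ / ε ^ 2)) ∧
        (ε ≤ H * κ →
          (∃ n : ℕ, 0 < n ∧
            C₀ * ((H : ℝ) ^ 6 * (κ : ℝ) ^ 2 * VIGU.iota H S A p ε₀ / ε ^ 2) ≤ n ∧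
            n ≤ C₁ * ((H : ℝ) ^ 6 * (κ : ℝ) ^ 2 * VIGU.iota H S A p ε₀ / ε ^ 2)) ∧
          ∃ N : ℕ, M.IsSampleComplexity ε₀ ε p N ∧
            (N : ℝ) ≤ C₁ * ((H : ℝ) ^ 7 * Fintype.card S * Fintype.card A * (κ : ℝ) ^ 2
              * VIGU.iota H S A p ε₀ / ε ^ 2)) := by
  refine ⟨1 / 8, 64, 65, by norm_num, by norm_num, by norm_num, ?_⟩
  intro H S A _ _ _ _ _ _ _ _ M κ ε p ε₀ hH hK hε hp hp1 he heε
  refine ⟨fun n hn hnl => ⟨VIGU.succeeds_of_le M hn hH hK hε hp hp1 he heε hnl,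
    fun C hC => VIGU.numSamples_le hC⟩, fun hεK => ?_⟩
  have he1 : ε₀ ≤ 1 := by
    have := div_le_one_of_le₀ hεK (by positivity)
    linarith
  have hX := VIGU.one_le_rate (S := S) (A := A) hH hε hp hp1 he he1 hεK
  set X : ℝ := (H : ℝ) ^ 6 * (κ : ℝ) ^ 2 * VIGU.iota H S A p ε₀ / ε ^ 2 with hXdef
  have hn : 0 < ⌈64 * X⌉₊ := Nat.ceil_pos.2 (by linarith)
  have hnl : 64 * X ≤ ⌈64 * X⌉₊ := Nat.le_ceil _
  have hnu : (⌈64 * X⌉₊ : ℝ) ≤ 65 * X := by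
    have := Nat.ceil_lt_add_one (show 0 ≤ 64 * X by linarith)
    linarith
  refine ⟨⟨⌈64 * X⌉₊, hn, hnl, hnu⟩, ?_⟩
  have hmem : VIGU.numSamples H S A ⌈64 * X⌉₊ ∈ {m | ∃ n : ℕ, 0 < n ∧
      m = VIGU.numSamples H S A n ∧ M.Succeeds ε₀ ε p n} :=
    ⟨_, hn, rfl, VIGU.succeeds_of_le M hn hH hK hε hp hp1 he heε hnl⟩
  refine ⟨sInf {m | ∃ n : ℕ, 0 < n ∧ m = VIGU.numSamples H S A n ∧ M.Succeeds ε₀ ε p n},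
    ⟨Nat.sInf_mem ⟨_, hmem⟩, fun m hm => Nat.sInf_le hm⟩, ?_⟩
  exact (Nat.cast_le.2 (Nat.sInf_le hmem)).trans (VIGU.numSamples_le hnu)
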